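/- Let $n,m$ be nonnegative integers, $A\in\mathbb{C}^{n\times n}$, $B\in\mathbb{C}^{n\times m}$, let $R\in\mathbb{C}^{m\times m}$ be Hermitian and nonsingular, and let $H\in\mathbb{C}^{n\times n}$ be Hermitian. Write $\overline{M}$ for the entrywise conjugate of a matrix $M$, $M^H$ for its conjugate transpose, $\sigma(M)$ for its spectrum, $\rho(M)$ for its spectral radius and $\mu(M)=\min\{|\lambda| : \lambda\in\sigma(M)\}$ (with $\mu(M)=\infty$ for the $0\times0$ matrix). Hermitian matrices are ordered by $X\le Y$ iff $Y-X$ is positive semidefinite, and $M>0$ (resp. $M<0$) means that $M$ is positive (resp. negative) definite. For Hermitian $X\in\mathbb{C}^{n\times n}$ put $R_X=R+B^H\overline{X}B$, and let $$\mathrm{dom}(\mathcal{R})=\{X\in\mathbb{C}^{n\times n} : X^H=X,\ \det R_X\neq 0\},$$ $$\mathcal{R}(X)=A^H\overline{X}A-A^H\overline{X}BR_X^{-1}B^H\overline{X}A+H\qquad (X\in\mathrm{dom}(\mathcal{R})).$$ For $X\in\mathrm{dom}(\mathcal{R})$ let $T_X=A-BR_X^{-1}B^H\overline{X}A$ and $\widehat{T}_X=\overline{T_X}\,T_X$.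 Define the following subsets of $\mathrm{dom}(\mathcal{R})$: $\mathbb{R}_\le$, $\mathbb{R}_=$ and $\mathbb{R}_\ge$ consist of the $X\in\mathrm{dom}(\mathcal{R})$ with $X\le\mathcal{R}(X)$, $X=\mathcal{R}(X)$ and $X\ge\mathcal{R}(X)$, respectively; $$\mathbb{P}=\{X : R_X>0\},\quad \mathbb{E}=\{X : R_X<0\},\quad \mathbb{T}=\{X : \rho(\widehat{T}_X)<1\},\quad \mathbb{O}=\{X : \mu(\widehat{T}_X)>1\}.$$ If $A$ is nonsingular (which is the case whenever $\mathbb{O}\neq\emptyset$), let $H_A=(A^{-1})^H H A^{-1}$. For a set $S$ of Hermitian matrices, $\max(S)$ (resp. $\min(S)$) denotes an element of $S$ that is $\ge$ (resp. $\le$) every element of $S$. Then the following hold. 1. Assume that $\mathbb{R}_\le\cap\mathbb{P}\neq\emptyset$. (1a) If $\mathbb{T}\neq\emptyset$, then $\mathbf{X_M}=\max(\mathbb{R}_=\cap\mathbb{P})$ exists. (1b) If $\mathbb{O}\neq\emptyset$ and $\overline{H_A}\in\mathrm{dom}(\mathcal{R})$, then $\mathbf{X_m}=\min(\mathbb{R}_=\cap\mathbb{P})$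 exists. 2. Assume that $\mathbb{R}_\ge\cap\mathbb{E}\neq\emptyset$. (2a) If $\mathbb{O}\neq\emptyset$ and $\overline{H_A}\in\mathrm{dom}(\mathcal{R})$, then $\mathbf{Y_M}=\max(\mathbb{R}_=\cap\mathbb{E})$ exists. (2b) If $\mathbb{T}\neq\emptyset$, then $\mathbf{Y_m}=\min(\mathbb{R}_=\cap\mathbb{E})$ exists. -/

import Mathlib

open scoped Matrix ComplexOrder MatrixOrder

/-- The coefficient matrices `A, B, R, H` of a conjugate discrete-time algebraic Riccati
equation.  The standing assumptions (`R` Hermitian and nonsingular, `H` Hermitian) are stated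
where they are used. -/
structure CDARE (n m : ℕ) where
  A : Matrix (Fin n) (Fin n) ℂ
  B : Matrix (Fin n) (Fin m) ℂ
  R : Matrix (Fin m) (Fin m) ℂ
  H : Matrix (Fin n) (Fin n) ℂ

namespace CDARE

variable {n m : ℕ}

/-- The entrywise complex conjugate of a matrix (without transposition). -/
def conj {k l : ℕ} (M : Matrix (Fin k) (Fin l) ℂ) : Matrix (Fin k) (Fin l) ℂ :=
  M.map (starRingEnd ℂ)

/-- The smallest modulus of an eigenvalue, `μ(M) = min {|z| : z ∈ σ(M)}`, as an extended
nonnegative real; it is the counterpart of Mathlib's `spectralRadius`.  (For a `0 × 0` matrix,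
which has no eigenvalue, it is `∞`.) -/
noncomputable def minModulus {k : ℕ} (M : Matrix (Fin k) (Fin k) ℂ) : ENNReal :=
  ⨅ z ∈ spectrum ℂ M, (‖z‖₊ : ENNReal)

/-- `R_X = R + Bᴴ X̄ B`. -/
def RX (E : CDARE n m) (X : Matrix (Fin n) (Fin n) ℂ) : Matrix (Fin m) (Fin m) ℂ :=
  E.R + E.Bᴴ * conj X * E.B

/-- The domain of the Riccati operator: the Hermitian `X` with `R_X` nonsingular. -/
def dom (E : CDARE n m) : Set (Matrix (Fin n) (Fin n) ℂ) :=
  {X | X.IsHermitian ∧ (E.RX X).det ≠ 0}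

/-- The Riccati operator `Aᴴ X̄ A - Aᴴ X̄ B R_X⁻¹ Bᴴ X̄ A + H`, meaningful on `E.dom`. -/
noncomputable def riccati (E : CDARE n m) (X : Matrix (Fin n) (Fin n) ℂ) :
    Matrix (Fin n) (Fin n) ℂ :=
  E.Aᴴ * conj X * E.A - E.Aᴴ * conj X * E.B * (E.RX X)⁻¹ * E.Bᴴ * conj X * E.A + E.H

/-- `F_X = R_X⁻¹ Bᴴ X̄ A`. -/
noncomputable def FX (E : CDARE n m) (X : Matrix (Fin n) (Fin n) ℂ) :
    Matrix (Fin m) (Fin n) ℂ :=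
  (E.RX X)⁻¹ * E.Bᴴ * conj X * E.A

/-- `T_X = A - B F_X`. -/
noncomputable def TX (E : CDARE n m) (X : Matrix (Fin n) (Fin n) ℂ) :
    Matrix (Fin n) (Fin n) ℂ :=
  E.A - E.B * E.FX X

/-- The product of the conjugate of `T_X` with `T_X`. -/
noncomputable def THat (E : CDARE n m) (X : Matrix (Fin n) (Fin n) ℂ) :
    Matrix (Fin n) (Fin n) ℂ :=
  conj (E.TX X) * E.TX X

/-- `ℝ_≤`: the `X` in the domain with `X ≤ 𝓡(X)` (Loewner order). -/
def setLE (E : CDARE n m) : Set (Matrix (Fin n) (Fin n) ℂ) :=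
  {X | X ∈ E.dom ∧ X ≤ E.riccati X}

/-- `ℝ_≥`: the `X` in the domain with `X ≥ 𝓡(X)` (Loewner order). -/
def setGE (E : CDARE n m) : Set (Matrix (Fin n) (Fin n) ℂ) :=
  {X | X ∈ E.dom ∧ E.riccati X ≤ X}

/-- `ℝ_=`: the Hermitian solutions of the equation `X = 𝓡(X)`. -/
def setEq (E : CDARE n m) : Set (Matrix (Fin n) (Fin n) ℂ) :=
  {X | X ∈ E.dom ∧ X = E.riccati X}

/-- `ℙ`: the `X` in the domain with `R_X` positive definite. -/
def setP (E : CDARE n m) : Set (Matrix (Fin n) (Fin n) ℂ) :=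
  {X | X ∈ E.dom ∧ (E.RX X).PosDef}

/-- `𝔼`: the `X` in the domain with `R_X` negative definite. -/
def setE (E : CDARE n m) : Set (Matrix (Fin n) (Fin n) ℂ) :=
  {X | X ∈ E.dom ∧ (-(E.RX X)).PosDef}

/-- `𝕋`: the `X` in the domain for which the spectral radius of `E.THat X` is below `1`. -/
def setT (E : CDARE n m) : Set (Matrix (Fin n) (Fin n) ℂ) :=
  {X | X ∈ E.dom ∧ spectralRadius ℂ (E.THat X) < 1}

/-- `𝕆`: the `X` in the domain for which all eigenvalues of `E.THat X` lie outside the closed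
unit disk. -/
def setO (E : CDARE n m) : Set (Matrix (Fin n) (Fin n) ℂ) :=
  {X | X ∈ E.dom ∧ 1 < minModulus (E.THat X)}

/-- `H_A = A⁻ᴴ H A⁻¹`, meaningful when `A` is nonsingular. -/
noncomputable def HA (E : CDARE n m) : Matrix (Fin n) (Fin n) ℂ :=
  (E.A⁻¹)ᴴ * E.H * E.A⁻¹

end CDARE

/-! Completing the square shows that, when `R_X` is positive definite, `𝓡(X)` is the least value
over all feedbacks `F` of `(A - BF)ᴴ X̄ (A - BF) + Fᴴ R F + H`. Hence `𝓡` is monotone there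
(`riccati_mono`) and lies below an affine Stein-type map for each `F` (`riccati_le`). If `F` is
stabilizing, that affine map has a fixed point `U`, which bounds `ℝ_≤ ∩ ℙ` above and satisfies `𝓡(U)
≤ U`. Among the upper bounds of `ℝ_≤ ∩ ℙ` in `[L, U]` with `𝓡(X) ≤ X`, one of least trace is a fixed
point, hence the maximal solution (`exists_isGreatest_of_isStabilizable`). A point of `𝕋` supplies a
stabilizing `F`.

For the minimum, `A` is inverted: `dualVar` reverses order and carries solutions to solutions of a
dual equation, which a point of `𝕆` makes stabilizable. Part 2 is part 1 for `(A, B, -R, -H)` and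
`-X`. -/

/-! ### Spectral radius, a fixed point principle, continuity of inversion. -/

section MatrixFacts

open scoped Matrix.Norms.L2Operator
open Filter Topology

theorem tendsto_pow_atTop_nhds_zero_of_spectralRadius_lt_one {𝔸 : Type*} [NormedRing 𝔸]
    [NormedAlgebra ℂ 𝔸] [CompleteSpace 𝔸] {a : 𝔸} (ha : spectralRadius ℂ a < 1) :
    Tendsto (fun k : ℕ => a ^ k) atTop (𝓝 0) := by
  obtain ⟨r, hr, hr1⟩ := ENNReal.lt_iff_exists_nnreal_btwn.1 ha
  have hlt := (spectrum.pow_nnnorm_pow_one_div_tendsto_nhds_spectralRadius a).eventually_lt_const hr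
  rw [tendsto_zero_iff_norm_tendsto_zero]
  refine squeeze_zero' (Eventually.of_forall fun k => norm_nonneg _) ?_
    (tendsto_pow_atTop_nhds_zero_of_lt_one r.2 (by exact_mod_cast hr1))
  filter_upwards [hlt, eventually_gt_atTop 0] with k hk hk0
  have h := ENNReal.rpow_le_rpow hk.le (Nat.cast_nonneg (α := ℝ) k)
  rw [← ENNReal.rpow_mul, one_div, inv_mul_cancel₀ (by positivity), ENNReal.rpow_one,
    ENNReal.rpow_natCast] at h
  exact_mod_cast h

variable {n : ℕ}

theorem spectralRadius_lt_one_of_forall_norm_lt_one {M : Matrix (Fin n) (Fin n) ℂ}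
    (h : ∀ z ∈ spectrum ℂ M, ‖z‖ < 1) : spectralRadius ℂ M < 1 := by
  rcases (spectrum ℂ M).eq_empty_or_nonempty with he | hne
  · simp [spectralRadius, he]
  · exact_mod_cast spectrum.spectralRadius_lt_of_forall_lt_of_nonempty hne (r := 1)
      (fun z hz => by exact_mod_cast h z hz)

/-- Order intervals are compact, so `S` has a point `X` of least trace. Then `X - f X` is positive
semidefinite with trace at most zero, hence zero. No continuity of `f` is needed. -/
theorem exists_fixedPoint_of_isClosed_of_forall_le {L U : Matrix (Fin n) (Fin n) ℂ}
    {S : Set (Matrix (Fin n) (Fin n) ℂ)} (hS : IsClosed S) (hne : S.Nonempty)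
    (hSI : S ⊆ Set.Icc L U) {f : Matrix (Fin n) (Fin n) ℂ → Matrix (Fin n) (Fin n) ℂ}
    (hf : ∀ X ∈ S, f X ∈ S) (hle : ∀ X ∈ S, f X ≤ X) : ∃ X ∈ S, X = f X := by
  have hc : IsCompact S := by
    refine Metric.isCompact_of_isClosed_isBounded hS ?_
    refine (Metric.isBounded_closedBall (x := L) (r := ‖U - L‖)).subset fun X hX => ?_
    rw [Metric.mem_closedBall, dist_eq_norm]
    exact CStarAlgebra.norm_le_norm_of_nonneg_of_le (sub_nonneg.2 (hSI hX).1)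
      (sub_le_sub_right (hSI hX).2 L)
  obtain ⟨X, hX, hmin⟩ := hc.exists_isMinOn hne
    (f := fun X : Matrix (Fin n) (Fin n) ℂ => X.trace.re)
    (Complex.continuous_re.comp continuous_id.matrix_trace).continuousOn
  refine ⟨X, hX, ?_⟩
  have hp : (X - f X).PosSemidef := hle X hX
  have h1 : X.trace.re ≤ (f X).trace.re := hmin (hf X hX)
  have h2 := Complex.le_def.1 hp.trace_nonneg
  have h3 : (X - f X).trace = 0 := by
    apply Complex.ext
    · have := h2.1
      simp only [Matrix.trace_sub, Complex.sub_re, Complex.zero_re] at this ⊢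
      linarith
    · exact h2.2.symm
  exact sub_eq_zero.1 (hp.trace_eq_zero_iff.1 h3)

theorem Matrix.continuousOn_inv : ContinuousOn (fun M : Matrix (Fin n) (Fin n) ℂ => M⁻¹)
    {M | M.det ≠ 0} := by
  intro M hM
  apply ContinuousAt.continuousWithinAt
  have h : (fun M : Matrix (Fin n) (Fin n) ℂ => M⁻¹) = fun M => M.det⁻¹ • M.adjugate := by
    funext M
    rw [Matrix.inv_def, Ring.inverse_eq_inv']
  rw [h]
  exact (continuous_id.matrix_det.continuousAt.inv₀ hM).smul
    continuous_id.matrix_adjugate.continuousAt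

end MatrixFacts

namespace CDARE

/-! ### Entrywise conjugation and congruence. -/

section Conj

variable {k l p : ℕ}

theorem conj_eq_transpose (M : Matrix (Fin k) (Fin l) ℂ) : conj M = Mᴴᵀ := rfl

@[simp]
theorem conj_conj (M : Matrix (Fin k) (Fin l) ℂ) : conj (conj M) = M := by
  ext; simp [conj]

@[simp]
theorem conj_mul (M : Matrix (Fin k) (Fin l) ℂ) (N : Matrix (Fin l) (Fin p) ℂ) :
    conj (M * N) = conj M * conj N := by
  simp [conj_eq_transpose]

@[simp]
theorem conj_add (M N : Matrix (Fin k) (Fin l) ℂ) : conj (M + N) = conj M + conj N := by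
  simp [conj_eq_transpose]

@[simp]
theorem conj_sub (M N : Matrix (Fin k) (Fin l) ℂ) : conj (M - N) = conj M - conj N := by
  simp [conj_eq_transpose]

@[simp]
theorem conj_neg (M : Matrix (Fin k) (Fin l) ℂ) : conj (-M) = -conj M := by
  simp [conj_eq_transpose]

theorem conj_conjTranspose (M : Matrix (Fin k) (Fin l) ℂ) : conj Mᴴ = (conj M)ᴴ := by
  ext; simp [conj]

theorem conj_inv (M : Matrix (Fin k) (Fin k) ℂ) : conj M⁻¹ = (conj M)⁻¹ := by
  simp [conj_eq_transpose, Matrix.conjTranspose_nonsing_inv, Matrix.transpose_nonsing_inv]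

theorem det_conj (M : Matrix (Fin k) (Fin k) ℂ) : (conj M).det = star M.det := by
  rw [conj_eq_transpose, Matrix.det_transpose, Matrix.det_conjTranspose]

theorem isHermitian_conj {M : Matrix (Fin k) (Fin k) ℂ} (h : M.IsHermitian) :
    (conj M).IsHermitian := by
  rw [conj_eq_transpose]
  exact h.conjTranspose.transpose

theorem conj_nonneg {M : Matrix (Fin k) (Fin k) ℂ} (h : 0 ≤ M) : 0 ≤ conj M := by
  rw [conj_eq_transpose]
  exact (Matrix.nonneg_iff_posSemidef.1 h).conjTranspose.transpose.nonneg

theorem conj_le_conj {M N : Matrix (Fin k) (Fin k) ℂ} (h : M ≤ N) : conj M ≤ conj N := by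
  simpa using conj_nonneg (sub_nonneg.2 h)

theorem continuous_conj : Continuous (conj : Matrix (Fin k) (Fin l) ℂ → _) :=
  continuous_id.matrix_map Complex.continuous_conj

theorem conjTranspose_mul_mul_nonneg {M : Matrix (Fin k) (Fin k) ℂ} (h : 0 ≤ M)
    (T : Matrix (Fin k) (Fin l) ℂ) : 0 ≤ Tᴴ * M * T :=
  ((Matrix.nonneg_iff_posSemidef.1 h).conjTranspose_mul_mul_same T).nonneg

theorem conjTranspose_mul_mul_le {M N : Matrix (Fin k) (Fin k) ℂ} (h : M ≤ N)
    (T : Matrix (Fin k) (Fin l) ℂ) : Tᴴ * M * T ≤ Tᴴ * N * T := by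
  rw [← sub_nonneg, ← Matrix.sub_mul, ← Matrix.mul_sub]
  exact conjTranspose_mul_mul_nonneg (sub_nonneg.2 h) T

end Conj

/-! ### The conjugate Stein equation. -/

section Stein

open scoped Matrix.Norms.L2Operator
open Filter Topology

variable {n : ℕ} {T : Matrix (Fin n) (Fin n) ℂ}

/-- The conjugate Stein operator is inverse positive when `conj T * T` is Schur stable. -/
theorem nonneg_of_stein_nonneg (hT : spectralRadius ℂ (conj T * T) < 1)
    {D : Matrix (Fin n) (Fin n) ℂ} (hD : 0 ≤ D - Tᴴ * conj D * T) : 0 ≤ D := by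
  set S := conj T * T with hS
  -- Substituting the inequality into its own conjugate removes the conjugation: with `Q = D - Tᴴ D̄
  -- T`, one has `D - Sᴴ D S = Q + Tᴴ Q̄ T`.
  have hQ : Sᴴ * D * S ≤ D := by
    have h2 := conjTranspose_mul_mul_nonneg (conj_nonneg hD) T
    have h3 := add_nonneg hD h2
    rw [← sub_nonneg]
    convert h3 using 1
    simp only [hS, conj_sub, conj_mul, conj_conj, conj_conjTranspose, Matrix.conjTranspose_mul,
      Matrix.mul_sub, Matrix.sub_mul, Matrix.mul_assoc]
    abel
  have hpow : ∀ k : ℕ, (S ^ k)ᴴ * D * S ^ k ≤ D := by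
    intro k
    induction k with
    | zero => simp
    | succ k ih =>
      refine le_trans (le_of_eq_of_le ?_ (conjTranspose_mul_mul_le ih S)) hQ
      simp only [pow_succ, Matrix.conjTranspose_mul, Matrix.mul_assoc]
  have hlim : Tendsto (fun k : ℕ => (S ^ k)ᴴ * D * S ^ k) atTop (𝓝 (0ᴴ * D * 0)) := by
    have h := tendsto_pow_atTop_nhds_zero_of_spectralRadius_lt_one hT
    exact (((continuous_id.matrix_conjTranspose.tendsto _).comp h).mul_const D).mul h
  simp only [Matrix.mul_zero] at hlim
  exact le_of_tendsto' hlim hpow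

/-- The operator is only real-linear, so it is considered on the real space of Hermitian matrices.
Inverse positivity applied to `X` and `-X` gives injectivity, and finite dimension gives
surjectivity. -/
theorem exists_stein_solution (hT : spectralRadius ℂ (conj T * T) < 1)
    {Q : Matrix (Fin n) (Fin n) ℂ} (hQ : Q.IsHermitian) :
    ∃ X : Matrix (Fin n) (Fin n) ℂ, X.IsHermitian ∧ X - Tᴴ * conj X * T = Q := by
  let V := selfAdjoint.submodule ℝ (Matrix (Fin n) (Fin n) ℂ)
  let Φ : V →ₗ[ℝ] V :=
    { toFun := fun X => ⟨X.1 - Tᴴ * conj X.1 * T, by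
        have hX : X.1ᴴ = X.1 := X.2
        change _ᴴ = _
        simp [Matrix.conjTranspose_mul, ← conj_conjTranspose, hX, Matrix.mul_assoc]⟩
      map_add' := fun X Y => by
        apply Subtype.ext
        change X.1 + Y.1 - _ = X.1 - _ + (Y.1 - _)
        simp only [Submodule.coe_add, conj_add, Matrix.mul_add, Matrix.add_mul]
        abel
      map_smul' := fun c X => by
        apply Subtype.ext
        have hc : conj (c • X.1) = c • conj X.1 := by
          ext; simp [conj]
        change c • X.1 - Tᴴ * conj (c • X.1) * T = c • (X.1 - Tᴴ * conj X.1 * T)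
        rw [hc, Matrix.mul_smul, Matrix.smul_mul, smul_sub] }
  have hinj : Function.Injective Φ := by
    rw [← LinearMap.ker_eq_bot, LinearMap.ker_eq_bot']
    intro X hX
    have hX' : X.1 - Tᴴ * conj X.1 * T = 0 := congrArg Subtype.val hX
    apply Subtype.ext
    refine le_antisymm ?_ (nonneg_of_stein_nonneg hT hX'.ge)
    refine neg_nonneg.1 (nonneg_of_stein_nonneg hT (le_of_eq ?_))
    rw [← neg_zero, ← hX', conj_neg, Matrix.mul_neg, Matrix.neg_mul]
    abel
  obtain ⟨X, hX⟩ := (LinearMap.injective_iff_surjective.1 hinj) ⟨Q, hQ⟩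
  exact ⟨X.1, X.2, congrArg Subtype.val hX⟩

end Stein
-- The nonlinear core of the Riccati operator.
section SchurForm

variable {n m : ℕ} {R : Matrix (Fin m) (Fin m) ℂ} {B : Matrix (Fin n) (Fin m) ℂ}
  {V W : Matrix (Fin n) (Fin n) ℂ}

/-- `V - V B (R + Bᴴ V B)⁻¹ Bᴴ V`. -/
noncomputable def schurForm (R : Matrix (Fin m) (Fin m) ℂ) (B : Matrix (Fin n) (Fin m) ℂ)
    (V : Matrix (Fin n) (Fin n) ℂ) : Matrix (Fin n) (Fin n) ℂ :=
  V - V * B * (R + Bᴴ * V * B)⁻¹ * Bᴴ * V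

theorem isHermitian_add_mul_mul (hR : R.IsHermitian) (hV : V.IsHermitian) :
    (R + Bᴴ * V * B).IsHermitian :=
  hR.add (Matrix.isHermitian_conjTranspose_mul_mul B hV)

theorem schurForm_isHermitian (hR : R.IsHermitian) (hV : V.IsHermitian) :
    (schurForm R B V).IsHermitian := by
  have hS := (isHermitian_add_mul_mul (B := B) hR hV).inv
  refine hV.sub ?_
  have h := Matrix.isHermitian_conjTranspose_mul_mul (Bᴴ * V) hS
  simpa only [Matrix.conjTranspose_mul, Matrix.conjTranspose_conjTranspose, hV.eq,
    Matrix.mul_assoc] using h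

/-- Completion of squares. -/
theorem schurForm_add_square (hR : R.IsHermitian) (hV : V.IsHermitian)
    (hdet : (R + Bᴴ * V * B).det ≠ 0) {k : ℕ} (A : Matrix (Fin n) (Fin k) ℂ)
    (F : Matrix (Fin m) (Fin k) ℂ) :
    Aᴴ * schurForm R B V * A +
      (F - (R + Bᴴ * V * B)⁻¹ * Bᴴ * V * A)ᴴ * (R + Bᴴ * V * B) *
        (F - (R + Bᴴ * V * B)⁻¹ * Bᴴ * V * A) =
      (A - B * F)ᴴ * V * (A - B * F) + Fᴴ * R * F := by
  have hS := isHermitian_add_mul_mul (B := B) hR hV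
  have hu : IsUnit (R + Bᴴ * V * B).det := hdet.isUnit
  have hexp : Fᴴ * (R + Bᴴ * V * B) * F = Fᴴ * R * F + Fᴴ * (Bᴴ * (V * (B * F))) := by
    simp only [Matrix.mul_add, Matrix.add_mul, Matrix.mul_assoc]
  set S := R + Bᴴ * V * B with hSdef
  have h1 : S * (S⁻¹ * Bᴴ * V * A) = Bᴴ * V * A := by
    simp only [← Matrix.mul_assoc, Matrix.mul_nonsing_inv _ hu, Matrix.one_mul]
  have h2 : (S⁻¹ * Bᴴ * V * A)ᴴ * S = Aᴴ * V * B := by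
    have h := congrArg Matrix.conjTranspose h1
    rw [Matrix.conjTranspose_mul, hS.eq] at h
    rw [h]
    simp [hV.eq, Matrix.mul_assoc]
  have h3 : (F - S⁻¹ * Bᴴ * V * A)ᴴ * S * (F - S⁻¹ * Bᴴ * V * A) =
      Fᴴ * S * F - Fᴴ * (Bᴴ * V * A) - Aᴴ * V * B * F + Aᴴ * V * B * (S⁻¹ * Bᴴ * V * A) := by
    rw [Matrix.conjTranspose_sub, Matrix.sub_mul _ _ S, h2, Matrix.mul_sub, Matrix.sub_mul,
      Matrix.sub_mul, Matrix.mul_assoc Fᴴ S (_ * A), h1]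
    abel
  rw [h3, hexp, schurForm, ← hSdef]
  simp only [Matrix.conjTranspose_sub, Matrix.conjTranspose_mul, Matrix.mul_sub, Matrix.sub_mul,
    Matrix.mul_assoc]
  abel

theorem schurForm_le (hR : R.IsHermitian) (hV : V.IsHermitian)
    (hS : (R + Bᴴ * V * B).PosDef) {k : ℕ} (A : Matrix (Fin n) (Fin k) ℂ)
    (F : Matrix (Fin m) (Fin k) ℂ) :
    Aᴴ * schurForm R B V * A ≤ (A - B * F)ᴴ * V * (A - B * F) + Fᴴ * R * F := by
  rw [← schurForm_add_square hR hV hS.det_pos.ne' A F]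
  exact le_add_of_nonneg_right (conjTranspose_mul_mul_nonneg hS.posSemidef.nonneg _)

theorem posDef_add_mul_mul_of_le (hVW : V ≤ W) (hS : (R + Bᴴ * V * B).PosDef) :
    (R + Bᴴ * W * B).PosDef := by
  have h := hS.add_posSemidef (Matrix.le_iff.1 (conjTranspose_mul_mul_le hVW B))
  rwa [add_assoc, add_sub_cancel] at h

/-- The gain `K` optimal for `W` makes the square vanish for `W`, while for `V` it still gives an
upper bound. -/
theorem schurForm_mono (hR : R.IsHermitian) (hV : V.IsHermitian) (hW : W.IsHermitian)
    (hVW : V ≤ W) (hS : (R + Bᴴ * V * B).PosDef) : schurForm R B V ≤ schurForm R B W := by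
  have hdet := (posDef_add_mul_mul_of_le hVW hS).det_pos.ne'
  set K := (R + Bᴴ * W * B)⁻¹ * Bᴴ * W * (1 : Matrix (Fin n) (Fin n) ℂ) with hK
  have h1 := schurForm_add_square hR hW hdet (1 : Matrix (Fin n) (Fin n) ℂ) K
  have h2 := schurForm_le hR hV hS (1 : Matrix (Fin n) (Fin n) ℂ) K
  rw [← hK, sub_self, Matrix.mul_zero, add_zero] at h1
  have h3 := h2.trans (add_le_add_left (conjTranspose_mul_mul_le hVW _) _)
  rw [← h1] at h3
  simpa using h3

/-- This carries definiteness to the dual equation: the new weight is congruent to the inverse of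
the old one. -/
theorem sub_conjTranspose_mul_schurForm_mul (hdet : (R + Bᴴ * V * B).det ≠ 0) :
    R + Bᴴ * (-schurForm R B V) * B = R * (R + Bᴴ * V * B)⁻¹ * R := by
  have hu : IsUnit (R + Bᴴ * V * B).det := hdet.isUnit
  have hM : Bᴴ * (-schurForm R B V) * B =
      Bᴴ * V * B * (R + Bᴴ * V * B)⁻¹ * (Bᴴ * V * B) - Bᴴ * V * B := by
    simp only [schurForm, Matrix.mul_neg, Matrix.neg_mul, Matrix.mul_sub, Matrix.sub_mul,
      Matrix.mul_assoc]
    abel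
  rw [hM]
  generalize Bᴴ * V * B = M at *
  obtain ⟨S, rfl⟩ : ∃ S, M = S - R := ⟨M + R, by abel⟩
  rw [add_sub_cancel] at hu ⊢
  simp only [Matrix.sub_mul, Matrix.mul_sub, Matrix.mul_nonsing_inv _ hu, Matrix.one_mul,
    Matrix.mul_assoc, Matrix.nonsing_inv_mul _ hu, Matrix.mul_one]
  abel

/-- For invertible `V` the form is `(V⁻¹ + B R⁻¹ Bᴴ)⁻¹`, which makes the involution evident; the
computation below does not need `V` invertible. -/
theorem schurForm_neg_schurForm (hRdet : R.det ≠ 0) (hdet : (R + Bᴴ * V * B).det ≠ 0) :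
    schurForm R B (-schurForm R B V) = -V := by
  have hu : IsUnit (R + Bᴴ * V * B).det := hdet.isUnit
  have hRu : IsUnit R.det := hRdet.isUnit
  have hM : Bᴴ * V * B = (R + Bᴴ * V * B) - R := by abel
  have h1 : schurForm R B V * B = V * B * (R + Bᴴ * V * B)⁻¹ * R := by
    have : schurForm R B V * B =
        V * B - V * B * ((R + Bᴴ * V * B)⁻¹ * (Bᴴ * V * B)) := by
      simp only [schurForm, Matrix.sub_mul, Matrix.mul_assoc]
    rw [this]
    nth_rw 2 [hM]
    rw [Matrix.mul_sub, Matrix.nonsing_inv_mul _ hu]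
    simp only [Matrix.mul_sub, Matrix.mul_one, Matrix.mul_assoc]
    abel
  have h2 : Bᴴ * schurForm R B V = R * (R + Bᴴ * V * B)⁻¹ * Bᴴ * V := by
    have : Bᴴ * schurForm R B V =
        Bᴴ * V - (Bᴴ * V * B) * (R + Bᴴ * V * B)⁻¹ * (Bᴴ * V) := by
      simp only [schurForm, Matrix.mul_sub, Matrix.mul_assoc]
    rw [this]
    nth_rw 1 [hM]
    rw [Matrix.sub_mul, Matrix.mul_nonsing_inv _ hu]
    simp only [Matrix.sub_mul, Matrix.one_mul, Matrix.mul_assoc]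
    abel
  have h3 : schurForm R B (-schurForm R B V) = -schurForm R B V -
      (schurForm R B V * B) * (R * (R + Bᴴ * V * B)⁻¹ * R)⁻¹ * (Bᴴ * schurForm R B V) := by
    rw [schurForm, sub_conjTranspose_mul_schurForm_mul hdet]
    simp only [Matrix.neg_mul, Matrix.mul_neg, neg_neg, Matrix.mul_assoc]
  have h4 : (schurForm R B V * B) * (R * (R + Bᴴ * V * B)⁻¹ * R)⁻¹ * (Bᴴ * schurForm R B V) =
      V * B * (R + Bᴴ * V * B)⁻¹ * Bᴴ * V := by
    rw [h1, h2, Matrix.mul_inv_rev, Matrix.mul_inv_rev, Matrix.nonsing_inv_nonsing_inv _ hu]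
    generalize R + Bᴴ * V * B = S at *
    calc _ = V * B * S⁻¹ * (R * R⁻¹) * S * (R⁻¹ * R) * S⁻¹ * Bᴴ * V := by
          simp only [Matrix.mul_assoc]
      _ = V * B * (S⁻¹ * S) * S⁻¹ * Bᴴ * V := by
          rw [Matrix.mul_nonsing_inv _ hRu, Matrix.nonsing_inv_mul _ hRu]
          simp only [Matrix.mul_one, Matrix.mul_assoc]
      _ = _ := by rw [Matrix.nonsing_inv_mul _ hu, Matrix.mul_one]
  rw [h3, h4, schurForm]
  abel

end SchurForm

/-! ### Monotonicity of the Riccati operator and the maximal solution. -/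

section Riccati

variable {n m : ℕ} {E : CDARE n m} {X Y : Matrix (Fin n) (Fin n) ℂ}

theorem riccati_eq (E : CDARE n m) (X : Matrix (Fin n) (Fin n) ℂ) :
    E.riccati X = E.Aᴴ * schurForm E.R E.B (conj X) * E.A + E.H := by
  simp only [riccati, schurForm, RX, Matrix.mul_sub, Matrix.sub_mul, Matrix.mul_assoc]

theorem riccati_le (hR : E.R.IsHermitian) (hX : X ∈ E.setP) (F : Matrix (Fin m) (Fin n) ℂ) :
    E.riccati X ≤
      (E.A - E.B * F)ᴴ * conj X * (E.A - E.B * F) + (Fᴴ * E.R * F + E.H) := by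
  rw [riccati_eq, ← add_assoc]
  exact add_le_add_left (schurForm_le hR (isHermitian_conj hX.1.1) hX.2 E.A F) _

theorem mem_setP_of_posDef (hX : X.IsHermitian) (h : (E.RX X).PosDef) : X ∈ E.setP :=
  ⟨⟨hX, h.det_pos.ne'⟩, h⟩

theorem mem_setP_of_le (hX : X ∈ E.setP) (hY : Y.IsHermitian) (hXY : X ≤ Y) : Y ∈ E.setP :=
  mem_setP_of_posDef hY (posDef_add_mul_mul_of_le (conj_le_conj hXY) hX.2)

theorem riccati_mono (hR : E.R.IsHermitian) (hX : X ∈ E.setP) (hY : Y.IsHermitian)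
    (hXY : X ≤ Y) : E.riccati X ≤ E.riccati Y := by
  rw [riccati_eq, riccati_eq]
  exact add_le_add_left (conjTranspose_mul_mul_le (schurForm_mono hR (isHermitian_conj hX.1.1)
    (isHermitian_conj hY) (conj_le_conj hXY) hX.2) _) _

theorem continuousOn_riccati (E : CDARE n m) : ContinuousOn E.riccati E.dom := by
  have hRX : Continuous E.RX :=
    continuous_const.add ((continuous_const.matrix_mul continuous_conj).matrix_mul
      continuous_const)
  have hinv : ContinuousOn (fun X => (E.RX X)⁻¹) E.dom :=
    Matrix.continuousOn_inv.comp hRX.continuousOn fun X hX => hX.2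
  have hc : ContinuousOn (conj : Matrix (Fin n) (Fin n) ℂ → _) E.dom :=
    continuous_conj.continuousOn
  rw [continuousOn_iff_continuous_domRestrict] at hinv hc ⊢
  have h1 : Continuous fun X : E.dom => E.Aᴴ * conj X.1 := continuous_const.matrix_mul hc
  exact ((h1.matrix_mul continuous_const).sub (((((h1.matrix_mul continuous_const).matrix_mul
    hinv).matrix_mul continuous_const).matrix_mul hc).matrix_mul continuous_const)).add
    continuous_const

/-- `(A, B)` can be stabilised by state feedback, in the sense adapted to the conjugate
equation. -/
def IsStabilizable (E : CDARE n m) : Prop :=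
  ∃ F : Matrix (Fin m) (Fin n) ℂ,
    spectralRadius ℂ (conj (E.A - E.B * F) * (E.A - E.B * F)) < 1

theorem isHermitian_of_le (hX : X.IsHermitian) (hXY : X ≤ Y) : Y.IsHermitian := by
  have h := (Matrix.le_iff.1 hXY).isHermitian.add hX
  rwa [sub_add_cancel] at h

open scoped Matrix.Norms.L2Operator in
theorem exists_isGreatest_of_isStabilizable (hR : E.R.IsHermitian) (hH : E.H.IsHermitian)
    (hne : (E.setLE ∩ E.setP).Nonempty) (hF : E.IsStabilizable) :
    ∃ X, IsGreatest (E.setEq ∩ E.setP) X := by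
  obtain ⟨L, hL⟩ := hne
  obtain ⟨F, hF⟩ := hF
  obtain ⟨U, hUH, hU⟩ := exists_stein_solution hF
    (Q := Fᴴ * E.R * F + E.H) ((Matrix.isHermitian_conjTranspose_mul_mul F hR).add hH)
  have hUb : U ∈ upperBounds (E.setLE ∩ E.setP) := by
    intro Z hZ
    refine sub_nonneg.1 (nonneg_of_stein_nonneg hF ?_)
    have h := hZ.1.2.trans (riccati_le hR hZ.2 F)
    rw [← hU] at h
    rw [← sub_nonneg] at h
    convert h using 1
    simp only [conj_sub, Matrix.mul_sub, Matrix.sub_mul]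
    abel
  have hPL : ∀ Z, L ≤ Z → Z ∈ E.setP := fun Z hZ =>
    mem_setP_of_le hL.2 (isHermitian_of_le hL.2.1.1 hZ) hZ
  have hRU : E.riccati U ≤ U := by
    have h := riccati_le hR (hPL U (hUb hL)) F
    rwa [← hU, add_sub_cancel] at h
  -- Requiring upper bounds makes the fixed point dominate every solution; `L ≤ X` keeps `X` in `ℙ`,
  -- where `𝓡` is continuous and monotone.
  set S := upperBounds (E.setLE ∩ E.setP) ∩
    (Set.Icc L U ∩ (fun X => X - E.riccati X) ⁻¹' Set.Ici 0) with hS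
  have hclosed : IsClosed S := by
    have hub : upperBounds (E.setLE ∩ E.setP) = ⋂ Z ∈ E.setLE ∩ E.setP, Set.Ici Z := by
      ext
      simp [upperBounds]
    rw [hS, hub]
    refine (isClosed_biInter fun Z _ => isClosed_Ici).inter
      (ContinuousOn.preimage_isClosed_of_isClosed ?_ isClosed_Icc isClosed_Ici)
    exact continuousOn_id.sub ((continuousOn_riccati E).mono fun X hX => (hPL X hX.1).1)
  have hle : ∀ X ∈ S, E.riccati X ≤ X := fun X hX => sub_nonneg.1 hX.2.2
  have hmaps : ∀ X ∈ S, E.riccati X ∈ S := by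
    intro X hX
    have hub : E.riccati X ∈ upperBounds (E.setLE ∩ E.setP) := fun Z hZ =>
      hZ.1.2.trans (riccati_mono hR hZ.2 (hPL X hX.2.1.1).1.1 (hX.1 hZ))
    refine ⟨hub, ⟨hub hL, (hle X hX).trans hX.2.1.2⟩, ?_⟩
    change 0 ≤ E.riccati X - E.riccati (E.riccati X)
    rw [sub_nonneg]
    exact riccati_mono hR (hPL _ (hub hL)) (hPL X hX.2.1.1).1.1 (hle X hX)
  obtain ⟨X, hX, hfix⟩ := exists_fixedPoint_of_isClosed_of_forall_le hclosed
    ⟨U, hUb, ⟨hUb hL, le_rfl⟩, sub_nonneg.2 hRU⟩ (fun X hX => hX.2.1) hmaps hle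
  have hXP := hPL X hX.2.1.1
  exact ⟨X, ⟨⟨hXP.1, hfix⟩, hXP⟩, fun Z hZ => hX.1 ⟨⟨hZ.1.1, hZ.1.2.le⟩, hZ.2⟩⟩

end Riccati
-- Duality by inverting `A`, and the minimal solution.
section Dual

variable {n m : ℕ} {E : CDARE n m} {X Y : Matrix (Fin n) (Fin n) ℂ}

/-- The dual equation, whose coefficients are `conj A⁻¹, B, R, conj H_A`. -/
noncomputable def dual (E : CDARE n m) : CDARE n m :=
  ⟨conj E.A⁻¹, E.B, E.R, conj E.HA⟩

/-- The order-reversing change of variable between an equation and its dual. -/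
noncomputable def dualVar (E : CDARE n m) (X : Matrix (Fin n) (Fin n) ℂ) :
    Matrix (Fin n) (Fin n) ℂ :=
  -conj ((E.A⁻¹)ᴴ * (X - E.H) * E.A⁻¹)

theorem HA_isHermitian (hH : E.H.IsHermitian) : E.HA.IsHermitian :=
  Matrix.isHermitian_conjTranspose_mul_mul _ hH

theorem dual_H_isHermitian (hH : E.H.IsHermitian) : E.dual.H.IsHermitian :=
  isHermitian_conj (HA_isHermitian hH)

theorem dualVar_isHermitian (hH : E.H.IsHermitian) (hX : X.IsHermitian) :
    (E.dualVar X).IsHermitian :=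
  (isHermitian_conj (Matrix.isHermitian_conjTranspose_mul_mul _ (hX.sub hH))).neg

theorem conj_dualVar (E : CDARE n m) (X : Matrix (Fin n) (Fin n) ℂ) :
    conj (E.dualVar X) = -((E.A⁻¹)ᴴ * (X - E.H) * E.A⁻¹) := by
  rw [dualVar, conj_neg, conj_conj]

theorem dual_A_det_ne_zero (hA : E.A.det ≠ 0) : E.dual.A.det ≠ 0 := by
  have h : (E.A⁻¹).det ≠ 0 := (Matrix.isUnit_nonsing_inv_det _ hA.isUnit).ne_zero
  change (conj E.A⁻¹).det ≠ 0
  rw [det_conj]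
  exact star_ne_zero.2 h

theorem dual_A_inv (hA : E.A.det ≠ 0) : E.dual.A⁻¹ = conj E.A := by
  change (conj E.A⁻¹)⁻¹ = _
  rw [← conj_inv, Matrix.nonsing_inv_nonsing_inv _ hA.isUnit]

theorem conjTranspose_mul_conjTranspose_inv (hA : E.A.det ≠ 0) : E.Aᴴ * (E.A⁻¹)ᴴ = 1 := by
  rw [← Matrix.conjTranspose_mul, Matrix.nonsing_inv_mul _ hA.isUnit, Matrix.conjTranspose_one]

theorem conjTranspose_inv_mul_conjTranspose (hA : E.A.det ≠ 0) : (E.A⁻¹)ᴴ * E.Aᴴ = 1 := by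
  rw [← Matrix.conjTranspose_mul, Matrix.mul_nonsing_inv _ hA.isUnit, Matrix.conjTranspose_one]

theorem conjTranspose_mul_inv_conj (hA : E.A.det ≠ 0) (M : Matrix (Fin n) (Fin n) ℂ) :
    E.Aᴴ * ((E.A⁻¹)ᴴ * M * E.A⁻¹) * E.A = M := by
  calc _ = (E.Aᴴ * (E.A⁻¹)ᴴ) * M * (E.A⁻¹ * E.A) := by simp only [Matrix.mul_assoc]
    _ = M := by
      rw [conjTranspose_mul_conjTranspose_inv hA, Matrix.nonsing_inv_mul _ hA.isUnit,
        Matrix.one_mul, Matrix.mul_one]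

theorem inv_conj_conjTranspose_mul (hA : E.A.det ≠ 0) (M : Matrix (Fin n) (Fin n) ℂ) :
    (E.A⁻¹)ᴴ * (E.Aᴴ * M * E.A) * E.A⁻¹ = M := by
  calc _ = ((E.A⁻¹)ᴴ * E.Aᴴ) * M * (E.A * E.A⁻¹) := by simp only [Matrix.mul_assoc]
    _ = M := by
      rw [conjTranspose_inv_mul_conjTranspose hA, Matrix.mul_nonsing_inv _ hA.isUnit,
        Matrix.one_mul, Matrix.mul_one]

theorem dual_dual (hA : E.A.det ≠ 0) : E.dual.dual = E := by
  have hAA : conj E.dual.A⁻¹ = E.A := by rw [dual_A_inv hA, conj_conj]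
  have hHH : conj E.dual.HA = E.H := by
    rw [HA, dual_A_inv hA]
    change conj ((conj E.A)ᴴ * conj E.HA * conj E.A) = _
    simp only [conj_mul, conj_conjTranspose, conj_conj]
    exact conjTranspose_mul_inv_conj hA _
  obtain ⟨A, B, R, H⟩ := E
  simp only [dual] at hAA hHH ⊢
  rw [hAA, hHH]

theorem dualVar_dualVar (hA : E.A.det ≠ 0) (X : Matrix (Fin n) (Fin n) ℂ) :
    E.dual.dualVar (E.dualVar X) = X := by
  rw [dualVar, dual_A_inv hA]
  change -conj ((conj E.A)ᴴ * (E.dualVar X - conj E.HA) * conj E.A) = X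
  simp only [conj_mul, conj_conjTranspose, conj_conj, conj_sub, conj_dualVar]
  have h : -((E.A⁻¹)ᴴ * (X - E.H) * E.A⁻¹) - E.HA = -((E.A⁻¹)ᴴ * X * E.A⁻¹) := by
    rw [HA, Matrix.mul_sub, Matrix.sub_mul]
    abel
  rw [h, Matrix.mul_neg, Matrix.neg_mul, neg_neg, conjTranspose_mul_inv_conj hA]

theorem dualVar_antitone (E : CDARE n m) : Antitone E.dualVar := fun _ _ h =>
  neg_le_neg (conj_le_conj (conjTranspose_mul_mul_le (sub_le_sub_right h _) _))

/-- Splitting `conj H_A` this way reduces comparing `dualVar X` with its dual Riccati image to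
comparing `schurForm` with `-X̄`. -/
theorem dual_riccati_eq_add (E : CDARE n m) (X : Matrix (Fin n) (Fin n) ℂ) :
    E.dual.riccati (E.dualVar X) = (conj E.A⁻¹)ᴴ *
      (schurForm E.R E.B (conj (E.dualVar X)) + conj X) * conj E.A⁻¹ + E.dualVar X := by
  rw [riccati_eq]
  change (conj E.A⁻¹)ᴴ * schurForm E.R E.B (conj (E.dualVar X)) * conj E.A⁻¹ + conj E.HA = _
  simp only [dualVar, HA, conj_mul, conj_sub, conj_conjTranspose, Matrix.mul_add, Matrix.add_mul,
    Matrix.mul_sub, Matrix.sub_mul]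
  abel

theorem posDef_mul_inv_mul {k : ℕ} {R S : Matrix (Fin k) (Fin k) ℂ} (hR : R.IsHermitian)
    (hRdet : R.det ≠ 0) (hS : S.PosDef) : (R * S⁻¹ * R).PosDef := by
  have h := hS.inv.conjTranspose_mul_mul_same (B := R)
    (Matrix.mulVec_injective_of_isUnit ((Matrix.isUnit_iff_isUnit_det _).2 hRdet.isUnit))
  rwa [hR.eq] at h

/-- Cancelling `A` in `X ≤ 𝓡(X)` gives `-schurForm X̄ ≤ conj (dualVar X)`; monotonicity and the
involution then give `-X̄ ≤ schurForm (conj (dualVar X))`. -/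
theorem dualVar_mem_setLE_inter_setP (hR : E.R.IsHermitian) (hRdet : E.R.det ≠ 0)
    (hH : E.H.IsHermitian) (hA : E.A.det ≠ 0) (hX : X ∈ E.setLE ∩ E.setP) :
    E.dualVar X ∈ E.dual.setLE ∩ E.dual.setP := by
  have hXH := hX.2.1.1
  have hdet := hX.2.2.det_pos.ne'
  have hle : -schurForm E.R E.B (conj X) ≤ conj (E.dualVar X) := by
    rw [conj_dualVar, neg_le_neg_iff]
    have h := conjTranspose_mul_mul_le
      (sub_le_sub_right (hX.1.2.trans_eq (riccati_eq E X)) E.H) E.A⁻¹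
    rwa [add_sub_cancel_right, inv_conj_conjTranspose_mul hA] at h
  have hpos : (E.R + E.Bᴴ * (-schurForm E.R E.B (conj X)) * E.B).PosDef := by
    rw [sub_conjTranspose_mul_schurForm_mul hdet]
    exact posDef_mul_inv_mul hR hRdet hX.2.2
  have hZ := dualVar_isHermitian hH hXH
  have hP : E.dualVar X ∈ E.dual.setP :=
    mem_setP_of_posDef hZ (posDef_add_mul_mul_of_le hle hpos)
  refine ⟨⟨hP.1, ?_⟩, hP⟩
  have h := schurForm_mono hR (schurForm_isHermitian hR (isHermitian_conj hXH)).neg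
    (isHermitian_conj hZ) hle hpos
  rw [schurForm_neg_schurForm hRdet hdet] at h
  rw [dual_riccati_eq_add]
  exact le_add_of_nonneg_left (conjTranspose_mul_mul_nonneg (neg_le_iff_add_nonneg.1 h) _)

theorem dualVar_mem_setEq_inter_setP (hR : E.R.IsHermitian) (hRdet : E.R.det ≠ 0)
    (hH : E.H.IsHermitian) (hA : E.A.det ≠ 0) (hX : X ∈ E.setEq ∩ E.setP) :
    E.dualVar X ∈ E.dual.setEq ∩ E.dual.setP := by
  have hmem := dualVar_mem_setLE_inter_setP hR hRdet hH hA ⟨⟨hX.1.1, hX.1.2.le⟩, hX.2⟩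
  refine ⟨⟨hmem.1.1, ?_⟩, hmem.2⟩
  have hV : conj (E.dualVar X) = -schurForm E.R E.B (conj X) := by
    have h : X - E.H = E.Aᴴ * schurForm E.R E.B (conj X) * E.A :=
      sub_eq_iff_eq_add.2 (hX.1.2.trans (riccati_eq E X))
    rw [conj_dualVar, h, inv_conj_conjTranspose_mul hA]
  rw [dual_riccati_eq_add, hV, schurForm_neg_schurForm hRdet hX.1.1.2, neg_add_cancel,
    Matrix.mul_zero, Matrix.zero_mul, zero_add]

theorem exists_isLeast_of_dual_isStabilizable (hR : E.R.IsHermitian) (hRdet : E.R.det ≠ 0)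
    (hH : E.H.IsHermitian) (hA : E.A.det ≠ 0) (hne : (E.setLE ∩ E.setP).Nonempty)
    (hF : E.dual.IsStabilizable) : ∃ X, IsLeast (E.setEq ∩ E.setP) X := by
  obtain ⟨L, hL⟩ := hne
  have hH' := dual_H_isHermitian hH
  obtain ⟨Z, hZ, hmax⟩ := exists_isGreatest_of_isStabilizable (E := E.dual) hR hH'
    ⟨_, dualVar_mem_setLE_inter_setP hR hRdet hH hA hL⟩ hF
  refine ⟨E.dual.dualVar Z, ?_, fun Y hY => ?_⟩
  · have h := dualVar_mem_setEq_inter_setP (E := E.dual) hR hRdet hH' (dual_A_det_ne_zero hA) hZ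
    rwa [dual_dual hA] at h
  · have h := E.dual.dualVar_antitone (hmax (dualVar_mem_setEq_inter_setP hR hRdet hH hA hY))
    rwa [dualVar_dualVar hA] at h

theorem det_ne_zero_of_zero_notMem_spectrum {k : ℕ} {M : Matrix (Fin k) (Fin k) ℂ}
    (h : (0 : ℂ) ∉ spectrum ℂ M) : M.det ≠ 0 :=
  ((Matrix.isUnit_iff_isUnit_det M).1 (spectrum.zero_notMem_iff ℂ |>.1 h)).ne_zero

theorem one_lt_norm_of_one_lt_minModulus {k : ℕ} {M : Matrix (Fin k) (Fin k) ℂ}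
    (h : 1 < minModulus M) {z : ℂ} (hz : z ∈ spectrum ℂ M) : 1 < ‖z‖ := by
  have h' : (1 : ENNReal) < ‖z‖₊ := h.trans_le (iInf₂_le z hz)
  exact_mod_cast h'

theorem norm_lt_one_of_mem_spectrum_inv {k : ℕ} {M : Matrix (Fin k) (Fin k) ℂ}
    (hM : M.det ≠ 0) (h : ∀ z ∈ spectrum ℂ M, z ≠ 0 → 1 < ‖z‖) {z : ℂ}
    (hz : z ∈ spectrum ℂ M⁻¹) : ‖z‖ < 1 := by
  have hu : IsUnit M := (Matrix.isUnit_iff_isUnit_det M).2 hM.isUnit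
  have hz0 : z ≠ 0 := by
    rintro rfl
    refine (spectrum.zero_notMem_iff ℂ).2 ?_ hz
    exact (Matrix.isUnit_nonsing_inv_iff).2 hu
  obtain ⟨u, rfl⟩ := hu
  rw [← Matrix.coe_units_inv] at hz
  have hz' : z⁻¹ ∈ spectrum ℂ (u : Matrix (Fin k) (Fin k) ℂ) := spectrum.inv₀_mem_iff.2 hz
  have h1 := h _ hz' (inv_ne_zero hz0)
  rw [norm_inv] at h1
  exact (one_lt_inv₀ (norm_pos_iff.2 hz0)).1 h1

theorem TX_eq_mul (E : CDARE n m) (X : Matrix (Fin n) (Fin n) ℂ) :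
    E.TX X = (1 - E.B * ((E.RX X)⁻¹ * E.Bᴴ * conj X)) * E.A := by
  simp only [TX, FX, Matrix.sub_mul, Matrix.one_mul, Matrix.mul_assoc]

theorem THat_det_ne_zero_of_mem_setO (hX : X ∈ E.setO) : (E.THat X).det ≠ 0 := by
  refine det_ne_zero_of_zero_notMem_spectrum fun h => ?_
  have := one_lt_norm_of_one_lt_minModulus hX.2 h
  norm_num at this

theorem A_det_ne_zero_of_mem_setO (hX : X ∈ E.setO) : E.A.det ≠ 0 := by
  have h := THat_det_ne_zero_of_mem_setO hX
  rw [THat, TX_eq_mul, Matrix.det_mul, Matrix.det_mul] at h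
  exact right_ne_zero_of_mul (right_ne_zero_of_mul h)

/-- Here `T_X = P A` with `P = 1 - B K`. Since `P⁻¹ = 1 + B K P⁻¹`, the matrix `P⁻¹ conj A⁻¹` is a
closed loop of the dual equation. -/
theorem dual_isStabilizable_of_mem_setO (hX : X ∈ E.setO) : E.dual.IsStabilizable := by
  have hdet := THat_det_ne_zero_of_mem_setO hX
  have hspec := fun z (hz : z ∈ spectrum ℂ (E.THat X)) =>
    one_lt_norm_of_one_lt_minModulus hX.2 hz
  rw [THat, TX_eq_mul] at hdet hspec
  set K := (E.RX X)⁻¹ * E.Bᴴ * conj X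
  set P := 1 - E.B * K with hP
  have hPdet : P.det ≠ 0 := by
    rw [Matrix.det_mul, Matrix.det_mul P] at hdet
    exact left_ne_zero_of_mul (right_ne_zero_of_mul hdet)
  have hPinv : P⁻¹ = 1 + E.B * K * P⁻¹ := by
    have h := Matrix.mul_nonsing_inv P hPdet.isUnit
    nth_rw 1 [hP] at h
    rw [Matrix.sub_mul, Matrix.one_mul, sub_eq_iff_eq_add] at h
    exact h
  refine ⟨-(K * P⁻¹ * conj E.A⁻¹), ?_⟩
  have hT : E.dual.A - E.dual.B * (-(K * P⁻¹ * conj E.A⁻¹)) = P⁻¹ * conj E.A⁻¹ := by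
    change conj E.A⁻¹ - E.B * _ = _
    nth_rw 2 [hPinv]
    rw [Matrix.add_mul, Matrix.one_mul, Matrix.mul_neg, sub_neg_eq_add]
    simp only [Matrix.mul_assoc]
  -- The matrix inverted here is a cyclic rearrangement of `THat X`, so both have the same nonzero
  -- eigenvalues.
  have hN : conj (P⁻¹ * conj E.A⁻¹) * (P⁻¹ * conj E.A⁻¹) =
      (conj E.A * P * E.A * conj P)⁻¹ := by
    simp only [Matrix.mul_inv_rev, conj_mul, conj_conj, conj_inv, Matrix.mul_assoc]
  have hM : conj (P * E.A) * (P * E.A) = conj P * (conj E.A * P * E.A) := by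
    simp only [conj_mul, Matrix.mul_assoc]
  rw [hT, hN]
  rw [hM] at hdet hspec
  refine spectralRadius_lt_one_of_forall_norm_lt_one fun z hz =>
    norm_lt_one_of_mem_spectrum_inv ?_ (fun w hw hw0 => ?_) hz
  · rwa [Matrix.det_mul_comm]
  · refine hspec w ?_
    have h : w ∈ spectrum ℂ (conj E.A * P * E.A * conj P) \ {0} := ⟨hw, hw0⟩
    rw [spectrum.nonzero_mul_comm] at h
    exact h.1

theorem isStabilizable_of_mem_setT (hX : X ∈ E.setT) : E.IsStabilizable :=
  ⟨E.FX X, hX.2⟩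

end Dual

/-! ### Sign change, exchanging `ℙ` with `𝔼` and maxima with minima. -/

section Neg

variable {n m : ℕ} {E : CDARE n m} {X : Matrix (Fin n) (Fin n) ℂ}

/-- The equation with coefficients `A, B, -R, -H`, satisfied by the negatives of the solutions. -/
def neg (E : CDARE n m) : CDARE n m :=
  ⟨E.A, E.B, -E.R, -E.H⟩

theorem neg_neg' (E : CDARE n m) : E.neg.neg = E := by
  simp [neg]

theorem neg_RX_neg (E : CDARE n m) (X : Matrix (Fin n) (Fin n) ℂ) :
    E.neg.RX (-X) = -E.RX X := by
  simp only [neg, RX, conj_neg, Matrix.mul_neg, Matrix.neg_mul, neg_add]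

theorem neg_inv {k : ℕ} (M : Matrix (Fin k) (Fin k) ℂ) : (-M)⁻¹ = -M⁻¹ := by
  by_cases h : IsUnit M.det
  · refine Matrix.inv_eq_left_inv ?_
    rw [neg_mul_neg, Matrix.nonsing_inv_mul _ h]
  · have h' : ¬IsUnit (-M).det := by
      rw [← Matrix.isUnit_iff_isUnit_det] at h ⊢
      rwa [IsUnit.neg_iff]
    rw [Matrix.nonsing_inv_apply_not_isUnit _ h, Matrix.nonsing_inv_apply_not_isUnit _ h',
      neg_zero]

theorem neg_riccati_neg (E : CDARE n m) (X : Matrix (Fin n) (Fin n) ℂ) :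
    E.neg.riccati (-X) = -E.riccati X := by
  rw [riccati, riccati, neg_RX_neg, neg_inv]
  simp only [neg, conj_neg, Matrix.mul_neg, Matrix.neg_mul, neg_neg]
  abel

/-- The two signs in `R_X⁻¹ Bᴴ X̄` cancel, so the sign change preserves `𝕋` and `𝕆`. -/
theorem neg_TX_neg (E : CDARE n m) (X : Matrix (Fin n) (Fin n) ℂ) :
    E.neg.TX (-X) = E.TX X := by
  rw [TX, TX, FX, FX, neg_RX_neg, neg_inv]
  simp only [neg, conj_neg, Matrix.mul_neg, Matrix.neg_mul, neg_neg]

theorem neg_THat_neg (E : CDARE n m) (X : Matrix (Fin n) (Fin n) ℂ) :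
    E.neg.THat (-X) = E.THat X := by
  rw [THat, THat, neg_TX_neg]

theorem neg_mem_dom_neg (hX : X ∈ E.dom) : -X ∈ E.neg.dom := by
  refine ⟨hX.1.neg, ?_⟩
  rw [neg_RX_neg, Matrix.det_neg]
  exact mul_ne_zero (pow_ne_zero _ (neg_ne_zero.2 one_ne_zero)) hX.2

theorem neg_mem_setLE_inter_setP (hX : X ∈ E.setGE ∩ E.setE) :
    -X ∈ E.neg.setLE ∩ E.neg.setP := by
  have hdom := neg_mem_dom_neg hX.1.1
  refine ⟨⟨hdom, ?_⟩, hdom, ?_⟩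
  · rw [neg_riccati_neg]
    exact neg_le_neg hX.1.2
  · rw [neg_RX_neg]
    exact hX.2.2

theorem neg_mem_setEq_inter_setP (hX : X ∈ E.setEq ∩ E.setE) :
    -X ∈ E.neg.setEq ∩ E.neg.setP := by
  have hdom := neg_mem_dom_neg hX.1.1
  refine ⟨⟨hdom, ?_⟩, hdom, ?_⟩
  · rw [neg_riccati_neg, ← hX.1.2]
  · rw [neg_RX_neg]
    exact hX.2.2

theorem neg_mem_setEq_inter_setE (hX : X ∈ E.neg.setEq ∩ E.neg.setP) :
    -X ∈ E.setEq ∩ E.setE := by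
  have hdom := neg_mem_dom_neg hX.1.1
  have hric := neg_riccati_neg E.neg X
  have hRX := neg_RX_neg E.neg X
  rw [neg_neg'] at hdom hric hRX
  refine ⟨⟨hdom, ?_⟩, hdom, ?_⟩
  · rw [hric, ← hX.1.2]
  · rw [hRX, neg_neg]
    exact hX.2.2

theorem neg_mem_setT_neg (hX : X ∈ E.setT) : -X ∈ E.neg.setT :=
  ⟨neg_mem_dom_neg hX.1, by rw [neg_THat_neg]; exact hX.2⟩

theorem neg_mem_setO_neg (hX : X ∈ E.setO) : -X ∈ E.neg.setO :=
  ⟨neg_mem_dom_neg hX.1, by rw [neg_THat_neg]; exact hX.2⟩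

theorem exists_isLeast_of_neg (h : ∃ X, IsGreatest (E.neg.setEq ∩ E.neg.setP) X) :
    ∃ Y, IsLeast (E.setEq ∩ E.setE) Y := by
  obtain ⟨X, hX, hmax⟩ := h
  exact ⟨-X, neg_mem_setEq_inter_setE hX, fun Y hY =>
    neg_le.1 (hmax (neg_mem_setEq_inter_setP hY))⟩

theorem exists_isGreatest_of_neg (h : ∃ X, IsLeast (E.neg.setEq ∩ E.neg.setP) X) :
    ∃ Y, IsGreatest (E.setEq ∩ E.setE) Y := by
  obtain ⟨X, hX, hmin⟩ := h
  exact ⟨-X, neg_mem_setEq_inter_setE hX, fun Y hY =>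
    le_neg.1 (hmin (neg_mem_setEq_inter_setP hY))⟩

end Neg

/-! ### Extremal solutions. -/

section Extremal

variable {n m : ℕ} {E : CDARE n m}

theorem exists_isGreatest_setEq_inter_setP (hR : E.R.IsHermitian) (hH : E.H.IsHermitian)
    (hne : (E.setLE ∩ E.setP).Nonempty) (hT : E.setT.Nonempty) :
    ∃ X, IsGreatest (E.setEq ∩ E.setP) X := by
  obtain ⟨_, hX⟩ := hT
  exact exists_isGreatest_of_isStabilizable hR hH hne (isStabilizable_of_mem_setT hX)

theorem exists_isLeast_setEq_inter_setP (hR : E.R.IsHermitian) (hRdet : E.R.det ≠ 0)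
    (hH : E.H.IsHermitian) (hne : (E.setLE ∩ E.setP).Nonempty) (hO : E.setO.Nonempty) :
    ∃ X, IsLeast (E.setEq ∩ E.setP) X := by
  obtain ⟨_, hX⟩ := hO
  exact exists_isLeast_of_dual_isStabilizable hR hRdet hH (A_det_ne_zero_of_mem_setO hX) hne
    (dual_isStabilizable_of_mem_setO hX)

end Extremal

end CDARE

theorem mainTheorem1 {n m : ℕ} (E : CDARE n m)
    (hR : E.R.IsHermitian) (hRdet : E.R.det ≠ 0) (hH : E.H.IsHermitian) :
    ((E.setLE ∩ E.setP).Nonempty →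
      (E.setT.Nonempty → ∃ X, IsGreatest (E.setEq ∩ E.setP) X) ∧
      (E.setO.Nonempty → CDARE.conj E.HA ∈ E.dom → ∃ X, IsLeast (E.setEq ∩ E.setP) X)) ∧
    ((E.setGE ∩ E.setE).Nonempty →
      (E.setO.Nonempty → CDARE.conj E.HA ∈ E.dom → ∃ Y, IsGreatest (E.setEq ∩ E.setE) Y) ∧
      (E.setT.Nonempty → ∃ Y, IsLeast (E.setEq ∩ E.setE) Y)) := by
  refine ⟨fun hne => ⟨fun hT => CDARE.exists_isGreatest_setEq_inter_setP hR hH hne hT,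
    fun hO _ => CDARE.exists_isLeast_setEq_inter_setP hR hRdet hH hne hO⟩, ?_⟩
  rintro ⟨X, hX⟩
  have hRdet' : E.neg.R.det ≠ 0 := by
    change (-E.R).det ≠ 0
    rw [Matrix.det_neg]
    exact mul_ne_zero (pow_ne_zero _ (neg_ne_zero.2 one_ne_zero)) hRdet
  have hne : (E.neg.setLE ∩ E.neg.setP).Nonempty := ⟨-X, CDARE.neg_mem_setLE_inter_setP hX⟩
  refine ⟨?_, ?_⟩
  · rintro ⟨Y, hY⟩ -
    exact CDARE.exists_isGreatest_of_neg (CDARE.exists_isLeast_setEq_inter_setP hR.neg hRdet'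
      hH.neg hne ⟨-Y, CDARE.neg_mem_setO_neg hY⟩)
  · rintro ⟨Y, hY⟩
    exact CDARE.exists_isLeast_of_neg (CDARE.exists_isGreatest_setEq_inter_setP hR.neg
      hH.neg hne ⟨-Y, CDARE.neg_mem_setT_neg hY⟩)
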